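/- Let $n\ge 0$, and let $\mathcal S_n$ be the set of permutations of $\{1,\dots,n\}$. For $\pi\in\mathcal S_3$, a permutation $\sigma\in\mathcal S_n$ is called $\pi$-avoiding if there are no indices $i_1<i_2<i_3$ such that $(\sigma(i_1),\sigma(i_2),\sigma(i_3))$ is in the same relative order as $(\pi(1),\pi(2),\pi(3))$; it is an involution if $\sigma=\sigma^{-1}$. Let $\mathrm{fp}(\sigma)$ be the number of $i$ with $\sigma(i)=i$ (fixed points), $\mathrm{exc}(\sigma)$ the number of $i$ with $\sigma(i)>i$ (excedances), $\ell(\sigma)$ the length of the longest increasing subsequence of $(\sigma(1),\dots,\sigma(n))$, and $\mathrm{rk}(\sigma)$ (the rank) the largest $r$ with $0\le r\le n$ such that $\sigma(i)>r$ for all $i\le r$. Then for all $0\le i,j,k\le n$, the number of 321-avoiding involutions $\sigma\in\mathcal S_n$ with $\mathrm{fp}(\sigma)=i$, $\mathrm{exc}(\sigma)=j$ and $\ell(\sigma)=k$ equals the number of 132-avoiding involutions $\sigma\in\mathcal S_n$ with $\mathrm{fp}(\sigma)=i$, $\mathrm{exc}(\sigma)=j$ and $\mathrm{rk}(\sigma)=n-k$.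 -/

import Mathlib

namespace RestrictedPerm

/-- `σ` contains the pattern `π`: some subsequence of `σ`, read at increasing positions
`f 0 < f 1 < ⋯`, is in the same relative order as `π`. -/
def Contains {n m : ℕ} (σ : Equiv.Perm (Fin n)) (π : Equiv.Perm (Fin m)) : Prop :=
  ∃ f : Fin m → Fin n, StrictMono f ∧ ∀ a b : Fin m, σ (f a) < σ (f b) ↔ π a < π b

/-- `σ` is `π`-avoiding. -/
def Avoids {n m : ℕ} (σ : Equiv.Perm (Fin n)) (π : Equiv.Perm (Fin m)) : Prop :=
  ¬ Contains σ π

/-- The permutation `321` in one-line notation (`0 ↦ 2, 1 ↦ 1, 2 ↦ 0` with indices from `0`). -/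
def p321 : Equiv.Perm (Fin 3) := Equiv.swap 0 2

/-- The permutation `132` in one-line notation (`0 ↦ 0, 1 ↦ 2, 2 ↦ 1` with indices from `0`). -/
def p132 : Equiv.Perm (Fin 3) := Equiv.swap 1 2

/-- Number of fixed points. -/
def fp {n : ℕ} (σ : Equiv.Perm (Fin n)) : ℕ :=
  (Finset.univ.filter fun i : Fin n => σ i = i).card

/-- Number of excedances, i.e. of the `i` with `σ i > i`. -/
def exc {n : ℕ} (σ : Equiv.Perm (Fin n)) : ℕ :=
  (Finset.univ.filter fun i : Fin n => i < σ i).card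

/-- Length of the longest increasing subsequence: the largest size of a set of positions
on which `σ` is increasing. -/
def lis {n : ℕ} (σ : Equiv.Perm (Fin n)) : ℕ :=
  (Finset.univ.filter fun s : Finset (Fin n) => ∀ i ∈ s, ∀ j ∈ s, i < j → σ i < σ j).sup
    Finset.card

/-- The rank: the largest `k ≤ n` such that `σ(i) > k` for all `i ≤ k`, positions and values
being numbered from `1`. Position `i : Fin n` has number `i + 1`, so `i + 1 ≤ k` reads `i < k`,
and `σ i + 1 > k` reads `k ≤ σ i`. -/
def rk {n : ℕ} (σ : Equiv.Perm (Fin n)) : ℕ :=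
  Nat.findGreatest (fun k => ∀ i : Fin n, (i : ℕ) < k → k ≤ (σ i : ℕ)) n

end RestrictedPerm

namespace RestrictedPerm

/-! On these two classes every statistic is a function of `exc`. Any involution has `fp σ + 2 * exc
σ = n`; a 321-avoiding one has `lis σ = n - exc σ`, and a 132-avoiding one has `rk σ = exc σ`. It
therefore suffices to count each class by `exc`, and both counts are `ballotNumber n j`.

For 321, the deficiency set is the down-step set of a ballot path. It determines the excedances
(`IsLevelPath.left_unique`), hence the involution (`Avoids.ext_of_p321`), and every ballot path
arises by matching ups with downs in order (`queueMatch`). For 132, the excedances are an initial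
segment; removing a point next to its end gives the recurrence of the ballot numbers
(`ncard_involutions132_succ_succ`). -/

theorem avoids_p321_iff {n : ℕ} (σ : Equiv.Perm (Fin n)) :
    Avoids σ p321 ↔ ∀ x y z, x < y → y < z → σ z < σ y → σ y < σ x → False := by
  constructor
  · intro h x y z hxy hyz h1 h2
    refine h ⟨![x, y, z], ?_, ?_⟩
    · intro a b hab
      fin_cases a <;> fin_cases b <;> simp_all [lt_trans hxy hyz]
    · have h3 := h1.trans h2
      intro a b
      fin_cases a <;> fin_cases b <;>
        simp [p321, Equiv.swap_apply_def, h1, h2, h3, h1.le, h2.le, h3.le]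
  · rintro h ⟨f, hf, hs⟩
    exact h (f 0) (f 1) (f 2) (hf (by decide)) (hf (by decide))
      ((hs 2 1).2 (by decide)) ((hs 1 0).2 (by decide))

theorem avoids_p132_iff {n : ℕ} (σ : Equiv.Perm (Fin n)) :
    Avoids σ p132 ↔ ∀ x y z, x < y → y < z → σ x < σ z → σ z < σ y → False := by
  constructor
  · intro h x y z hxy hyz h1 h2
    refine h ⟨![x, y, z], ?_, ?_⟩
    · intro a b hab
      fin_cases a <;> fin_cases b <;> simp_all [lt_trans hxy hyz]
    · have h3 := h1.trans h2
      intro a b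
      fin_cases a <;> fin_cases b <;>
        simp [p132, Equiv.swap_apply_def, h1, h2, h3, h1.le, h2.le, h3.le]
  · rintro h ⟨f, hf, hs⟩
    exact h (f 0) (f 1) (f 2) (hf (by decide)) (hf (by decide))
      ((hs 0 2).2 (by decide)) ((hs 2 1).2 (by decide))

/-! ### Statistics of involutions in terms of `exc` -/

theorem eq_inv_iff_apply_apply {α : Type*} (σ : Equiv.Perm α) : σ = σ⁻¹ ↔ ∀ x, σ (σ x) = x := by
  constructor
  · intro h x
    nth_rewrite 1 [h]
    simp
  · intro h
    ext x
    rw [Equiv.Perm.eq_inv_iff_eq, h]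

theorem card_deficiency_eq_exc {n : ℕ} {σ : Equiv.Perm (Fin n)} (h : ∀ x, σ (σ x) = x) :
    (Finset.univ.filter fun i : Fin n => σ i < i).card = exc σ := by
  apply Finset.card_bij (fun i _ => σ i)
  · intro a ha
    simpa [h] using ha
  · intro a _ b _ hab
    exact σ.injective hab
  · intro b hb
    exact ⟨σ b, by simpa [h] using hb, h b⟩

theorem fp_add_two_mul_exc {n : ℕ} {σ : Equiv.Perm (Fin n)} (h : ∀ x, σ (σ x) = x) :
    fp σ + 2 * exc σ = n := by
  have h1 := Finset.card_filter_add_card_filter_not (s := (Finset.univ : Finset (Fin n)))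
    (fun i => σ i = i)
  have h2 := Finset.card_filter_add_card_filter_not
    (s := (Finset.univ.filter fun i : Fin n => ¬ σ i = i)) (fun i => i < σ i)
  rw [Finset.filter_filter, Finset.filter_filter] at h2
  have h3 := card_deficiency_eq_exc h
  have e1 : (Finset.univ.filter fun i : Fin n => ¬ σ i = i ∧ i < σ i) =
      Finset.univ.filter fun i : Fin n => i < σ i := by
    ext i; simp; exact fun h => h.ne'
  have e2 : (Finset.univ.filter fun i : Fin n => ¬ σ i = i ∧ ¬ i < σ i) =
      Finset.univ.filter fun i : Fin n => σ i < i := by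
    ext i; simp only [Finset.mem_filter, Finset.mem_univ, true_and]; omega
  rw [e1, e2, h3] at h2
  rw [Finset.card_univ, Fintype.card_fin] at h1
  unfold fp exc at *
  omega

/-- In an involution each `2`-cycle is an inversion, so an increasing subsequence omits
one point of each. -/
theorem lis_add_exc_le {n : ℕ} {σ : Equiv.Perm (Fin n)} (h : ∀ x, σ (σ x) = x) :
    lis σ + exc σ ≤ n := by
  have key : lis σ ≤ n - exc σ := by
    apply Finset.sup_le
    intro s hs
    simp only [Finset.mem_filter, Finset.mem_univ, true_and] at hs
    have : (Finset.univ.filter fun i : Fin n => i < σ i).card ≤ sᶜ.card := by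
      -- Each 2-cycle, indexed by its smaller point, is sent to one of its points outside `s`.
      apply Finset.card_le_card_of_injOn (fun i => if i ∈ s then σ i else i)
      · intro i hi
        simp only [Finset.coe_filter, Finset.mem_univ, true_and, Set.mem_ofPred_eq] at hi
        by_cases his : i ∈ s
        · simp only [his, if_true, Finset.coe_compl, Set.mem_compl_iff, Finset.mem_coe]
          intro h2
          have := hs i his _ h2 hi
          rw [h] at this
          exact absurd this hi.asymm
        · simp [his]
      · intro i hi j hj hij
        simp only [Finset.coe_filter, Finset.mem_univ, true_and, Set.mem_ofPred_eq] at hi hj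
        dsimp only at hij
        split_ifs at hij
        · exact σ.injective hij
        · rw [← hij, h] at hj
          exact absurd hi hj.asymm
        · rw [hij, h] at hi
          exact absurd hi hj.asymm
        · exact hij
    rw [Finset.card_compl, Fintype.card_fin] at this
    have h2 : s.card ≤ n := by simpa using Finset.card_le_univ s
    unfold exc
    omega
  have := fp_add_two_mul_exc h
  omega

/-- Otherwise `x < y < σ x` are positions carrying the values `σ x > σ y > x`, a 321. -/
theorem Avoids.strictMonoOn_weak_excedance {n : ℕ} {σ : Equiv.Perm (Fin n)}
    (h : ∀ x, σ (σ x) = x) (ha : Avoids σ p321) {x y : Fin n} (hxy : x < y)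
    (hy : y ≤ σ y) : σ x < σ y := by
  rw [avoids_p321_iff] at ha
  by_contra hc
  have h1 : σ y < σ x := lt_of_le_of_ne (not_lt.1 hc) fun e => hxy.ne (σ.injective e).symm
  exact ha x y (σ x) hxy (hy.trans_lt h1) (by rw [h]; exact hxy.trans_le hy) h1

/-- The weak excedances form an increasing subsequence of length `n - exc σ`, attaining the general
bound. -/
theorem lis_add_exc_of_avoids_p321 {n : ℕ} {σ : Equiv.Perm (Fin n)} (h : ∀ x, σ (σ x) = x)
    (ha : Avoids σ p321) : lis σ + exc σ = n := by
  refine le_antisymm (lis_add_exc_le h) ?_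
  have h1 : (Finset.univ.filter fun i : Fin n => i ≤ σ i).card ≤ lis σ := by
    apply Finset.le_sup (f := Finset.card)
    simp only [Finset.mem_filter, Finset.mem_univ, true_and]
    intro i _ j hj hij
    exact ha.strictMonoOn_weak_excedance h hij hj
  have h2 := Finset.card_filter_add_card_filter_not (s := (Finset.univ : Finset (Fin n)))
    (fun i => i ≤ σ i)
  simp only [not_le] at h2
  rw [card_deficiency_eq_exc h, Finset.card_univ, Fintype.card_fin] at h2
  omega

theorem card_filter_val_lt {n e : ℕ} (he : e ≤ n) :
    (Finset.univ.filter fun i : Fin n => (i : ℕ) < e).card = e := by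
  rw [Fin.card_filter_val_lt]
  omega

theorem exc_le {n : ℕ} (σ : Equiv.Perm (Fin n)) : exc σ ≤ n := by
  simpa [exc] using Finset.card_le_univ (Finset.univ.filter fun i : Fin n => i < σ i)

theorem exc_eq_of_lt_apply_iff {n e : ℕ} {σ : Equiv.Perm (Fin n)} (he : e ≤ n)
    (h : ∀ x, x < σ x ↔ (x : ℕ) < e) : exc σ = e := by
  unfold exc
  simp only [h]
  exact card_filter_val_lt he

/-- The excedances of a `132`-avoiding involution form an initial segment. -/
theorem lt_apply_iff_of_avoids_p132 {n : ℕ} {σ : Equiv.Perm (Fin n)} (h : ∀ x, σ (σ x) = x)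
    (ha : Avoids σ p132) (x : Fin n) : x < σ x ↔ (x : ℕ) < exc σ := by
  rw [avoids_p132_iff] at ha
  have down : ∀ a b : Fin n, a < b → b < σ b → a < σ a := by
    intro a b hab hb
    by_contra hc
    -- The positions `a < b < σ b` carry the values `σ a`, `σ b`, `b`, a 132 since `σ a ≤ a < b`.
    exact ha a b (σ b) hab hb (by rw [h]; omega) (by rw [h]; exact hb)
  constructor
  · intro hx
    have : (Finset.univ.filter fun i : Fin n => (i : ℕ) < x + 1).card ≤ exc σ := by
      apply Finset.card_le_card
      intro i hi
      simp only [Finset.mem_filter, Finset.mem_univ, true_and] at hi ⊢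
      rcases (Nat.lt_succ_iff.1 hi).lt_or_eq with h1 | h1
      · exact down i x h1 hx
      · rwa [Fin.ext h1]
    rw [card_filter_val_lt x.2] at this
    omega
  · intro hx
    by_contra hc
    have : exc σ ≤ (Finset.univ.filter fun i : Fin n => (i : ℕ) < x).card := by
      apply Finset.card_le_card
      intro i hi
      simp only [Finset.mem_filter, Finset.mem_univ, true_and] at hi ⊢
      by_contra h1
      rcases (not_lt.1 h1).lt_or_eq with h2 | h2
      · exact hc (down x i h2 hi)
      · rw [Fin.ext h2] at hc; exact hc hi
    rw [card_filter_val_lt x.2.le] at this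
    omega

theorem rk_eq_exc_of_avoids_p132 {n : ℕ} {σ : Equiv.Perm (Fin n)} (h : ∀ x, σ (σ x) = x)
    (ha : Avoids σ p132) : rk σ = exc σ := by
  have he := lt_apply_iff_of_avoids_p132 h ha
  unfold rk
  rw [Nat.findGreatest_eq_iff]
  refine ⟨exc_le σ, fun _ i hi => ?_, fun m hm hmn hc => ?_⟩
  · by_contra hc
    have h1 := (he (σ i)).2 (not_le.1 hc)
    rw [h] at h1
    exact absurd h1 ((he i).2 hi).asymm
  · have h1 := hc ⟨exc σ, by omega⟩ hm
    have h2 := (he ⟨exc σ, by omega⟩).1 (by rw [Fin.lt_def]; simp only; omega)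
    simp at h2

/-! ### Ballot paths and level paths -/

/-- The number of elements of `S` below `m`. -/
def countBelow (S : Finset ℕ) (m : ℕ) : ℕ := Nat.count (· ∈ S) m

theorem countBelow_zero (S : Finset ℕ) : countBelow S 0 = 0 := Nat.count_zero _

theorem countBelow_succ (S : Finset ℕ) (m : ℕ) :
    countBelow S (m + 1) = countBelow S m + if m ∈ S then 1 else 0 := Nat.count_succ _ _

theorem countBelow_mono (S : Finset ℕ) {m k : ℕ} (h : m ≤ k) : countBelow S m ≤ countBelow S k :=
  Nat.count_monotone _ h

theorem countBelow_eq_card (S : Finset ℕ) (m : ℕ) :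
    countBelow S m = (S.filter (· < m)).card := by
  unfold countBelow
  rw [Nat.count_eq_card_filter_range]
  congr 1
  ext x
  simp [and_comm]

theorem countBelow_eq_card_of_subset {S : Finset ℕ} {n m : ℕ} (h : S ⊆ Finset.range n)
    (hm : n ≤ m) : countBelow S m = S.card := by
  rw [countBelow_eq_card, Finset.filter_true_of_mem]
  intro x hx
  exact (Finset.mem_range.1 (h hx)).trans_le hm

theorem countBelow_insert {S : Finset ℕ} {a : ℕ} (ha : a ∉ S) (m : ℕ) :
    countBelow (insert a S) m = countBelow S m + if a < m then 1 else 0 := by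
  rw [countBelow_eq_card, countBelow_eq_card, Finset.filter_insert]
  split_ifs
  · rw [Finset.card_insert_of_notMem (by simp [ha])]
  · rfl

theorem countBelow_injective : Function.Injective countBelow := by
  intro S T h
  ext x
  have h1 := congrFun h (x + 1)
  rw [countBelow_succ, countBelow_succ, h] at h1
  split_ifs at h1 <;> simp_all

/-- `D` is the set of down-steps of a lattice path of length `n` that stays weakly above `0`. -/
def IsBallot (n : ℕ) (D : Finset ℕ) : Prop :=
  D ⊆ Finset.range n ∧ ∀ m ≤ n, 2 * countBelow D m ≤ m

/-- `E` and `D` are the sets of up-steps and down-steps of a lattice path of length `n` from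
level `0` to level `0` that stays weakly above `0`, whose other steps are flat at level `0`. -/
structure IsLevelPath (n : ℕ) (E D : Finset ℕ) : Prop where
  subset_left : E ⊆ Finset.range n
  subset_right : D ⊆ Finset.range n
  disjoint : Disjoint E D
  le : ∀ m, countBelow D m ≤ countBelow E m
  eq : ∀ m, m ∉ E → m ∉ D → countBelow D m = countBelow E m

namespace IsLevelPath

variable {n : ℕ} {E D : Finset ℕ}

theorem countBelow_eq (h : IsLevelPath n E D) {m : ℕ} (hm : n ≤ m) :
    countBelow D m = countBelow E m :=
  h.eq m (fun hc => absurd (Finset.mem_range.1 (h.subset_left hc)) (by omega))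
    (fun hc => absurd (Finset.mem_range.1 (h.subset_right hc)) (by omega))

theorem notMem_right (h : IsLevelPath n E D) {x : ℕ} (hx : x ∈ E) : x ∉ D :=
  Finset.disjoint_left.1 h.disjoint hx

theorem card_eq (h : IsLevelPath n E D) : D.card = E.card := by
  rw [← countBelow_eq_card_of_subset h.subset_left le_rfl,
    ← countBelow_eq_card_of_subset h.subset_right le_rfl, h.countBelow_eq le_rfl]

/-- The existential shows that the truncated subtraction is a true count, that of the flat steps
before `m`. -/
theorem countBelow_add (h : IsLevelPath n E D) (m : ℕ) :
    (∃ f, f + countBelow E m + countBelow D m = m) ∧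
      (m + 1 - countBelow E (m + 1) - countBelow D (m + 1) =
        m - countBelow E m - countBelow D m + if m ∈ E ∨ m ∈ D then 0 else 1) := by
  have key : ∀ m, ∃ f, f + countBelow E m + countBelow D m = m := by
    intro m
    induction m with
    | zero => exact ⟨0, by simp [countBelow_zero]⟩
    | succ m ih =>
      obtain ⟨f, hf⟩ := ih
      rw [countBelow_succ, countBelow_succ]
      by_cases h1 : m ∈ E
      · exact ⟨f, by rw [if_pos h1, if_neg (h.notMem_right h1)]; omega⟩
      · by_cases h2 : m ∈ D
        · exact ⟨f, by rw [if_neg h1, if_pos h2]; omega⟩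
        · exact ⟨f + 1, by rw [if_neg h1, if_neg h2]; omega⟩
  refine ⟨key m, ?_⟩
  obtain ⟨f, hf⟩ := key m
  rw [countBelow_succ, countBelow_succ]
  by_cases h1 : m ∈ E
  · rw [if_pos h1, if_neg (h.notMem_right h1), if_pos (Or.inl h1)]; omega
  · by_cases h2 : m ∈ D
    · rw [if_neg h1, if_pos h2, if_pos (Or.inr h2)]; omega
    · rw [if_neg h1, if_neg h2, if_neg (by tauto)]; omega

theorem isBallot (h : IsLevelPath n E D) : IsBallot n D := by
  refine ⟨h.subset_right, fun m _ => ?_⟩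
  obtain ⟨f, hf⟩ := (h.countBelow_add m).1
  have := h.le m
  omega

/-- The number of flat steps before `m` is the minimal later height of the path obtained by
turning flat steps into up-steps. -/
theorem flat_le {E' : Finset ℕ} (h : IsLevelPath n E D) (h' : IsLevelPath n E' D) (m : ℕ) :
    m - countBelow E m - countBelow D m ≤ m - countBelow E' m - countBelow D m := by
  -- `z` will be the first flat step of the `E'`-path at or after `m`; every position from `n` on
  -- counts as flat.
  have hex : ∃ z, m ≤ z ∧ z ∉ E' ∧ z ∉ D :=
    ⟨max m n, le_max_left _ _,
      fun hc => absurd (Finset.mem_range.1 (h'.subset_left hc)) (by omega),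
      fun hc => absurd (Finset.mem_range.1 (h'.subset_right hc)) (by omega)⟩
  obtain ⟨hz, hzE, hzD⟩ := Nat.find_spec hex
  have hmin := fun k => Nat.find_min (H := hex) (m := k)
  set z := Nat.find hex
  have hmono : ∀ k, m ≤ k → m - countBelow E m - countBelow D m ≤
      k - countBelow E k - countBelow D k := by
    intro k hk
    induction k, hk using Nat.le_induction with
    | base => exact le_rfl
    | succ k _ ih => rw [(h.countBelow_add k).2]; omega
  have hconst : ∀ k, m ≤ k → k ≤ z → k - countBelow E' k - countBelow D k =
      m - countBelow E' m - countBelow D m := by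
    intro k hk
    induction k, hk using Nat.le_induction with
    | base => exact fun _ => rfl
    | succ k hmk ih =>
      intro hkz
      have h1 := hmin k (by omega)
      have h2 : k ∈ E' ∨ k ∈ D := by tauto
      rw [(h'.countBelow_add k).2, ih (by omega), if_pos h2, add_zero]
  -- Flats of `E` before `m` are at most those before `z`, which are at most `z - 2 * countBelow D
  -- z`. This is the number of flats of `E'` before `z`, and also before `m`.
  have h1 := hmono z hz
  have h2 := hconst z hz le_rfl
  have h3 := h'.eq z hzE hzD
  have h4 := h.le z
  omega

theorem left_unique {E' : Finset ℕ} (h : IsLevelPath n E D) (h' : IsLevelPath n E' D) :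
    E = E' := by
  apply countBelow_injective
  ext m
  have h1 := h.flat_le h' m
  have h2 := h'.flat_le h m
  obtain ⟨f, hf⟩ := (h.countBelow_add m).1
  obtain ⟨f', hf'⟩ := (h'.countBelow_add m).1
  omega

end IsLevelPath

/-- A final down-step is paid for by turning the last flat step into an up-step; a final step
outside `D` is left flat. -/
theorem IsBallot.exists_isLevelPath {n : ℕ} {D : Finset ℕ} (h : IsBallot n D) :
    ∃ E, IsLevelPath n E D := by
  induction n generalizing D with
  | zero =>
    have : D = ∅ := by simpa using h.1
    subst this
    exact ⟨∅, by simp, by simp, by simp, fun _ => le_rfl, fun _ _ _ => rfl⟩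
  | succ n ih =>
    have hsub : Finset.range n ⊆ Finset.range (n + 1) := by simp
    by_cases hn : n ∈ D
    · have hin : insert n (D.erase n) = D := Finset.insert_erase hn
      set D' := D.erase n with hD'
      have hnD' : n ∉ D' := by simp [hD']
      have hc : ∀ m, countBelow D m = countBelow D' m + if n < m then 1 else 0 := by
        intro m
        rw [← hin, countBelow_insert hnD']
      have hb : IsBallot n D' := by
        refine ⟨fun x hx => ?_, fun m hm => ?_⟩
        · have h1 := Finset.mem_range.1 (h.1 (Finset.mem_of_mem_erase hx))
          have h2 := Finset.ne_of_mem_erase hx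
          rw [Finset.mem_range]; omega
        · have := h.2 m (by omega)
          rw [hc] at this
          omega
      obtain ⟨E, hE⟩ := ih hb
      -- Without a flat step, `n ≤ 2 * D'.card`, against the ballot condition at `n + 1`.
      have hex : (Finset.range n \ (E ∪ D')).Nonempty := by
        rw [Finset.sdiff_nonempty]
        intro hs
        have h1 := Finset.card_le_card hs
        have h2 := Finset.card_union_le E D'
        have h3 := h.2 (n + 1) le_rfl
        rw [hc, countBelow_eq_card_of_subset hE.subset_right (by omega)] at h3
        rw [← hE.card_eq] at h2
        simp at h1 h3
        omega
      obtain ⟨a, ha, hmax⟩ := Finset.exists_max_image _ id hex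
      simp only [Finset.mem_sdiff, Finset.mem_range, Finset.mem_union, not_or, id] at ha hmax
      obtain ⟨han, haE, haD⟩ := ha
      refine ⟨insert a E, ?_, h.1, ?_, ?_, ?_⟩
      · intro x hx
        rcases Finset.mem_insert.1 hx with rfl | hx
        · rw [Finset.mem_range]; omega
        · exact hsub (hE.subset_left hx)
      · rw [Finset.disjoint_left]
        intro x hx hxD
        rw [← hin] at hxD
        rcases Finset.mem_insert.1 hxD with rfl | hxD
        · rcases Finset.mem_insert.1 hx with rfl | hx
          · omega
          · simpa using hE.subset_left hx
        · rcases Finset.mem_insert.1 hx with rfl | hx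
          · exact haD hxD
          · exact hE.notMem_right hx hxD
      · intro m
        rw [hc, countBelow_insert haE]
        have := hE.le m
        split_ifs <;> omega
      · intro m hmE hmD
        rw [hc, countBelow_insert haE]
        rw [Finset.mem_insert, not_or] at hmE
        rw [← hin, Finset.mem_insert, not_or] at hmD
        have h1 := hE.eq m hmE.2 hmD.2
        have h2 : m < n → m ≤ a := fun hmn => hmax m ⟨hmn, hmE.2, hmD.2⟩
        have h3 := hmE.1
        have h4 := hmD.1
        split_ifs <;> omega
    · have hb : IsBallot n D := by
        refine ⟨fun x hx => ?_, fun m hm => h.2 m (by omega)⟩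
        have h1 := Finset.mem_range.1 (h.1 hx)
        have h2 : x ≠ n := fun e => hn (e ▸ hx)
        rw [Finset.mem_range]; omega
      obtain ⟨E, hE⟩ := ih hb
      exact ⟨E, hE.subset_left.trans hsub, h.1, hE.disjoint, hE.le, hE.eq⟩

/-! ### From a level path to a 321-avoiding involution -/

/-- The matching of the up-steps and the down-steps of a path in order of appearance. -/
noncomputable def queueMatch (E D : Finset ℕ) (x : ℕ) : ℕ :=
  if x ∈ E then Nat.nth (· ∈ D) (countBelow E x)
  else if x ∈ D then Nat.nth (· ∈ E) (countBelow D x) else x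

theorem nth_mem_of_lt_countBelow {S : Finset ℕ} {k m : ℕ} (h : k < countBelow S m) :
    Nat.nth (· ∈ S) k ∈ S ∧ countBelow S (Nat.nth (· ∈ S) k) = k ∧ Nat.nth (· ∈ S) k < m := by
  have h1 : ∀ hf : (Set.ofPred (· ∈ S)).Finite, k < hf.toFinset.card :=
    fun hf => h.trans_le (Nat.count_le_card hf m)
  exact ⟨Nat.nth_mem k h1, Nat.count_nth h1, Nat.nth_lt_of_lt_count h⟩

theorem countBelow_lt {S : Finset ℕ} {x m : ℕ} (hx : x ∈ S) (h : x < m) :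
    countBelow S x < countBelow S m := Nat.count_strict_mono (p := (· ∈ S)) hx h

namespace IsLevelPath

variable {n : ℕ} {E D : Finset ℕ}

theorem queueMatch_left (h : IsLevelPath n E D) {x : ℕ} (hx : x ∈ E) :
    queueMatch E D x ∈ D ∧ countBelow D (queueMatch E D x) = countBelow E x ∧
      x < queueMatch E D x := by
  have h1 : countBelow E x < countBelow D n := by
    rw [h.countBelow_eq le_rfl]
    exact countBelow_lt hx (Finset.mem_range.1 (h.subset_left hx))
  obtain ⟨h2, h3, -⟩ := nth_mem_of_lt_countBelow h1
  have h4 : queueMatch E D x = Nat.nth (· ∈ D) (countBelow E x) := if_pos hx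
  rw [h4]
  refine ⟨h2, h3, ?_⟩
  by_contra hc
  rcases (not_lt.1 hc).lt_or_eq with h5 | h5
  · have h6 := countBelow_lt h2 h5
    have h7 := h.le x
    omega
  · rw [h5] at h2
    exact h.notMem_right hx h2

theorem queueMatch_right (h : IsLevelPath n E D) {x : ℕ} (hx : x ∈ D) :
    queueMatch E D x ∈ E ∧ countBelow E (queueMatch E D x) = countBelow D x ∧
      queueMatch E D x < x := by
  have hxE : x ∉ E := fun hc => h.notMem_right hc hx
  have h1 : countBelow D x < countBelow E x := by
    have h2 := h.le (x + 1)
    rw [countBelow_succ, countBelow_succ, if_pos hx, if_neg hxE] at h2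
    omega
  have h4 : queueMatch E D x = Nat.nth (· ∈ E) (countBelow D x) := by
    rw [queueMatch, if_neg hxE, if_pos hx]
  rw [h4]
  exact nth_mem_of_lt_countBelow h1

theorem queueMatch_flat {x : ℕ} (hE : x ∉ E) (hD : x ∉ D) : queueMatch E D x = x := by
  rw [queueMatch, if_neg hE, if_neg hD]

theorem queueMatch_involutive (h : IsLevelPath n E D) : Function.Involutive (queueMatch E D) := by
  have inj : ∀ {S : Finset ℕ} {x y : ℕ}, x ∈ S → y ∈ S → countBelow S x = countBelow S y → x = y :=
    fun {S} _ _ hx hy e => Nat.count_injective (p := (· ∈ S)) hx hy e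
  intro x
  by_cases hE : x ∈ E
  · obtain ⟨h1, h2, -⟩ := h.queueMatch_left hE
    obtain ⟨h3, h4, -⟩ := h.queueMatch_right h1
    exact inj h3 hE (h4.trans h2)
  · by_cases hD : x ∈ D
    · obtain ⟨h1, h2, -⟩ := h.queueMatch_right hD
      obtain ⟨h3, h4, -⟩ := h.queueMatch_left h1
      exact inj h3 hD (h4.trans h2)
    · rw [queueMatch_flat hE hD, queueMatch_flat hE hD]

theorem queueMatch_lt (h : IsLevelPath n E D) {x : ℕ} (hx : x < n) : queueMatch E D x < n := by
  by_cases hE : x ∈ E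
  · exact Finset.mem_range.1 (h.subset_right (h.queueMatch_left hE).1)
  · by_cases hD : x ∈ D
    · exact Finset.mem_range.1 (h.subset_left (h.queueMatch_right hD).1)
    · rwa [queueMatch_flat hE hD]

theorem queueMatch_lt_iff (h : IsLevelPath n E D) (x : ℕ) : queueMatch E D x < x ↔ x ∈ D := by
  constructor
  · intro hx
    by_contra hD
    by_cases hE : x ∈ E
    · exact absurd hx (h.queueMatch_left hE).2.2.asymm
    · rw [queueMatch_flat hE hD] at hx
      exact lt_irrefl _ hx
  · exact fun hx => (h.queueMatch_right hx).2.2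

theorem lt_queueMatch_iff (h : IsLevelPath n E D) (x : ℕ) : x < queueMatch E D x ↔ x ∈ E := by
  constructor
  · intro hx
    by_contra hE
    by_cases hD : x ∈ D
    · exact absurd hx (h.queueMatch_right hD).2.2.asymm
    · rw [queueMatch_flat hE hD] at hx
      exact lt_irrefl _ hx
  · exact fun hx => (h.queueMatch_left hx).2.2

theorem queueMatch_lt_left (h : IsLevelPath n E D) {x y : ℕ} (hx : x ∈ E) (hy : y ∈ E)
    (hxy : x < y) : queueMatch E D x < queueMatch E D y := by
  by_contra hc
  have h1 := countBelow_mono D (not_lt.1 hc)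
  rw [(h.queueMatch_left hx).2.1, (h.queueMatch_left hy).2.1] at h1
  have := countBelow_lt hx hxy
  omega

theorem queueMatch_lt_right (h : IsLevelPath n E D) {x y : ℕ} (hx : x ∈ D) (hy : y ∈ D)
    (hxy : x < y) : queueMatch E D x < queueMatch E D y := by
  by_contra hc
  have h1 := countBelow_mono E (not_lt.1 hc)
  rw [(h.queueMatch_right hx).2.1, (h.queueMatch_right hy).2.1] at h1
  have := countBelow_lt hx hxy
  omega

/-- If `y` is an up-step so is `x`, and if `y` is a down-step so is `z`; the matching is increasing
on each kind. If `y` is flat, the path is at level 0 there, so all earlier ups are matched before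
`y`. -/
theorem queueMatch_no_321 (h : IsLevelPath n E D) {x y z : ℕ} (hxy : x < y) (hyz : y < z)
    (h1 : queueMatch E D z < queueMatch E D y) (h2 : queueMatch E D y < queueMatch E D x) :
    False := by
  by_cases hyE : y ∈ E
  · have := (h.queueMatch_left hyE).2.2
    exact absurd (h.queueMatch_lt_left ((h.lt_queueMatch_iff x).1 (by omega)) hyE hxy) h2.asymm
  · by_cases hyD : y ∈ D
    · have := (h.queueMatch_right hyD).2.2
      exact absurd (h.queueMatch_lt_right hyD ((h.queueMatch_lt_iff z).1 (by omega)) hyz) h1.asymm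
    · have hy := h.eq y hyE hyD
      rw [queueMatch_flat hyE hyD] at h2
      have hx : x ∈ E := (h.lt_queueMatch_iff x).1 (by omega)
      have h3 := countBelow_mono D h2.le
      rw [(h.queueMatch_left hx).2.1] at h3
      have := countBelow_lt hx hxy
      omega

end IsLevelPath
-- From a 321-avoiding involution to a level path
/-- The set of deficiencies of `σ`, as natural numbers. -/
def downSet {n : ℕ} (σ : Equiv.Perm (Fin n)) : Finset ℕ :=
  (Finset.univ.filter fun i : Fin n => σ i < i).map Fin.valEmbedding

/-- The set of excedances of `σ`, as natural numbers. -/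
def upSet {n : ℕ} (σ : Equiv.Perm (Fin n)) : Finset ℕ :=
  (Finset.univ.filter fun i : Fin n => i < σ i).map Fin.valEmbedding

theorem mem_downSet {n : ℕ} {σ : Equiv.Perm (Fin n)} {m : ℕ} :
    m ∈ downSet σ ↔ ∃ x : Fin n, σ x < x ∧ (x : ℕ) = m := by
  simp [downSet]

theorem mem_upSet {n : ℕ} {σ : Equiv.Perm (Fin n)} {m : ℕ} :
    m ∈ upSet σ ↔ ∃ x : Fin n, x < σ x ∧ (x : ℕ) = m := by
  simp [upSet]

theorem val_mem_downSet {n : ℕ} {σ : Equiv.Perm (Fin n)} {x : Fin n} :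
    (x : ℕ) ∈ downSet σ ↔ σ x < x := by
  rw [mem_downSet]
  exact ⟨fun ⟨y, hy, e⟩ => Fin.ext e ▸ hy, fun h => ⟨x, h, rfl⟩⟩

theorem val_mem_upSet {n : ℕ} {σ : Equiv.Perm (Fin n)} {x : Fin n} :
    (x : ℕ) ∈ upSet σ ↔ x < σ x := by
  rw [mem_upSet]
  exact ⟨fun ⟨y, hy, e⟩ => Fin.ext e ▸ hy, fun h => ⟨x, h, rfl⟩⟩

theorem countBelow_map (n m : ℕ) (s : Finset (Fin n)) :
    countBelow (s.map Fin.valEmbedding) m = (s.filter fun i : Fin n => (i : ℕ) < m).card := by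
  rw [countBelow_eq_card, Finset.filter_map, Finset.card_map]
  rfl

/-- The partner of a deficiency below `m` is an excedance below `m`. At a fixed point `m` the
converse holds, since `m` is a weak excedance and so `σ x < σ m = m` for `x < m`. -/
theorem Avoids.isLevelPath {n : ℕ} {σ : Equiv.Perm (Fin n)} (h : ∀ x, σ (σ x) = x)
    (ha : Avoids σ p321) : IsLevelPath n (upSet σ) (downSet σ) := by
  have hle : ∀ m, countBelow (downSet σ) m ≤ countBelow (upSet σ) m := by
    intro m
    rw [downSet, upSet, countBelow_map, countBelow_map]
    apply Finset.card_le_card_of_injOn σ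
    · intro x hx
      simp only [Finset.coe_filter, Finset.mem_filter, Finset.mem_univ, true_and,
        Set.mem_ofPred_eq, h] at hx ⊢
      omega
    · exact σ.injective.injOn
  refine ⟨fun m hm => ?_, fun m hm => ?_, ?_, hle, fun m hE hD => le_antisymm (hle m) ?_⟩
  · obtain ⟨x, -, rfl⟩ := mem_upSet.1 hm
    simp
  · obtain ⟨x, -, rfl⟩ := mem_downSet.1 hm
    simp
  · rw [Finset.disjoint_left]
    intro m hm
    obtain ⟨x, hx, rfl⟩ := mem_upSet.1 hm
    rw [val_mem_downSet]
    exact hx.asymm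
  · rw [downSet, upSet, countBelow_map, countBelow_map]
    apply Finset.card_le_card_of_injOn σ
    · intro x hx
      simp only [Finset.coe_filter, Finset.mem_filter, Finset.mem_univ, true_and,
        Set.mem_ofPred_eq, h] at hx ⊢
      refine ⟨hx.1, ?_⟩
      by_contra hc
      have hmn : m < n := by
        by_contra hmn
        have := (σ x).2
        omega
      have hfix : σ ⟨m, hmn⟩ = ⟨m, hmn⟩ := by
        have h1 := mt (val_mem_upSet (x := ⟨m, hmn⟩)).2 hE
        have h2 := mt (val_mem_downSet (x := ⟨m, hmn⟩)).2 hD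
        exact le_antisymm (not_lt.1 h1) (not_lt.1 h2)
      have h3 := ha.strictMonoOn_weak_excedance h (x := x) (y := ⟨m, hmn⟩) hx.2 hfix.ge
      rw [hfix] at h3
      exact hc h3
    · exact σ.injective.injOn

/-- The point `σ m` is a deficiency of `τ` too. Its `τ`-partner is not before `m`, where `σ` and `τ`
agree, and not `m`. If it is after `m`, monotonicity on weak excedances gives `τ m < σ m`. -/
theorem Avoids.not_apply_lt_apply {n : ℕ} {σ τ : Equiv.Perm (Fin n)} (hσ : ∀ x, σ (σ x) = x)
    (hτ : ∀ x, τ (τ x) = x) (ha : Avoids τ p321) (hD : ∀ x, σ x < x ↔ τ x < x) {m : Fin n}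
    (hlt : ∀ x < m, σ x = τ x) (hm : m < σ m) : ¬ σ m < τ m := by
  intro hc
  have h1 : τ (σ m) < σ m := (hD _).1 (by rwa [hσ])
  rcases lt_trichotomy (τ (σ m)) m with h2 | h2 | h2
  · have h3 := hlt _ h2
    rw [hτ] at h3
    have h4 := σ.injective h3
    omega
  · rw [← h2, hτ, h2] at hc
    exact lt_irrefl _ hc
  · have h3 := ha.strictMonoOn_weak_excedance hτ h2 (by rw [hτ]; exact h1.le)
    rw [hτ] at h3
    exact hc.asymm h3

theorem Avoids.ext_of_p321 {n : ℕ} {σ τ : Equiv.Perm (Fin n)} (hσ : ∀ x, σ (σ x) = x)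
    (hτ : ∀ x, τ (τ x) = x) (ha : Avoids σ p321) (ha' : Avoids τ p321)
    (hD : ∀ x, σ x < x ↔ τ x < x) (hE : ∀ x, x < σ x ↔ x < τ x) : σ = τ := by
  have key : ∀ m, σ m = τ m := by
    intro m
    induction m using WellFoundedLT.induction with
    | ind m ih =>
      rcases lt_trichotomy (σ m) m with h1 | h1 | h1
      · have h2 := ih _ h1
        rw [hσ] at h2
        nth_rewrite 2 [h2]
        rw [hτ]
      · have h2 := mt (hD m).2 (by rw [h1]; exact lt_irrefl m)
        have h3 := mt (hE m).2 (by rw [h1]; exact lt_irrefl m)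
        rw [h1]
        exact le_antisymm (not_lt.1 h2) (not_lt.1 h3)
      · exact le_antisymm
          (not_lt.1 (ha.not_apply_lt_apply hτ hσ (fun x => (hD x).symm)
            (fun x hx => (ih x hx).symm) ((hE m).1 h1)))
          (not_lt.1 (ha'.not_apply_lt_apply hσ hτ hD ih h1))
  exact Equiv.ext key

/-! ### Ballot numbers: the 321 count and the recurrence -/

/-- The number of lattice paths of length `n` with `j` down-steps that stay weakly above `0`. -/
noncomputable def ballotNumber (n j : ℕ) : ℕ := {D : Finset ℕ | IsBallot n D ∧ D.card = j}.ncard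

theorem ncard_p321_eq_ballotNumber (n j : ℕ) :
    {σ : Equiv.Perm (Fin n) | σ = σ⁻¹ ∧ Avoids σ p321 ∧ exc σ = j}.ncard = ballotNumber n j := by
  apply Set.ncard_congr (fun σ _ => downSet σ)
  · rintro σ ⟨h, ha, he⟩
    rw [eq_inv_iff_apply_apply] at h
    refine ⟨(ha.isLevelPath h).isBallot, ?_⟩
    rw [downSet, Finset.card_map, card_deficiency_eq_exc h, he]
  · rintro σ τ ⟨hσ, ha, -⟩ ⟨hτ, ha', -⟩ hD
    rw [eq_inv_iff_apply_apply] at hσ hτ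
    have h1 := ha.isLevelPath hσ
    rw [hD] at h1
    have hE := h1.left_unique (ha'.isLevelPath hτ)
    exact ha.ext_of_p321 hσ hτ ha' (fun x => by rw [← val_mem_downSet, hD, val_mem_downSet])
      (fun x => by rw [← val_mem_upSet, hE, val_mem_upSet])
  · rintro D ⟨hD, hj⟩
    obtain ⟨E, h⟩ := hD.exists_isLevelPath
    have hinv : Function.Involutive fun x : Fin n =>
        (⟨queueMatch E D x, h.queueMatch_lt x.2⟩ : Fin n) :=
      fun x => Fin.ext (h.queueMatch_involutive x)
    have hdown : downSet (hinv.toPerm _) = D := by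
      ext m
      rw [mem_downSet]
      constructor
      · rintro ⟨x, hx, rfl⟩
        exact (h.queueMatch_lt_iff x).1 hx
      · intro hm
        exact ⟨⟨m, Finset.mem_range.1 (h.subset_right hm)⟩, (h.queueMatch_lt_iff m).2 hm, rfl⟩
    refine ⟨hinv.toPerm _, ⟨?_, ?_, ?_⟩, hdown⟩
    · rw [eq_inv_iff_apply_apply]
      exact hinv
    · rw [avoids_p321_iff]
      intro x y z hxy hyz h1 h2
      exact h.queueMatch_no_321 hxy hyz h1 h2
    · have h1 := congrArg Finset.card hdown
      rwa [downSet, Finset.card_map, card_deficiency_eq_exc (σ := hinv.toPerm _) hinv, hj] at h1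

theorem finite_isBallot (n j : ℕ) : {D : Finset ℕ | IsBallot n D ∧ D.card = j}.Finite :=
  (Finset.range n).powerset.finite_toSet.subset fun _ hD => Finset.mem_powerset.2 hD.1.1

theorem ballotNumber_zero (n : ℕ) : ballotNumber n 0 = 1 := by
  unfold ballotNumber
  rw [Set.ncard_eq_one]
  refine ⟨∅, Set.eq_singleton_iff_unique_mem.2 ⟨⟨⟨by simp, fun m _ => ?_⟩, rfl⟩, ?_⟩⟩
  · simp [countBelow_eq_card]
  · rintro D ⟨-, h⟩
    exact Finset.card_eq_zero.1 h

theorem ballotNumber_eq_zero {n j : ℕ} (h : n < 2 * j) : ballotNumber n j = 0 := by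
  unfold ballotNumber
  rw [Set.ncard_eq_zero (finite_isBallot n j), Set.eq_empty_iff_forall_notMem]
  rintro D ⟨h1, h2⟩
  have := h1.2 n le_rfl
  rw [countBelow_eq_card_of_subset h1.1 le_rfl] at this
  omega

/-- Split on whether the last step is down. The hypothesis makes the ballot condition at `n + 1`
automatic. -/
theorem ballotNumber_succ_succ {n j : ℕ} (h : 2 * (j + 1) ≤ n + 1) :
    ballotNumber (n + 1) (j + 1) = ballotNumber n (j + 1) + ballotNumber n j := by
  have hn : ∀ {D}, IsBallot n D → n ∉ D := fun hD hc => by simpa using hD.1 hc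
  have hunion : {D : Finset ℕ | IsBallot (n + 1) D ∧ D.card = j + 1} =
      {D : Finset ℕ | IsBallot n D ∧ D.card = j + 1} ∪
        insert n '' {D : Finset ℕ | IsBallot n D ∧ D.card = j} := by
    ext D
    constructor
    · rintro ⟨hD, hc⟩
      by_cases hnD : n ∈ D
      · right
        refine ⟨D.erase n, ⟨⟨fun x hx => ?_, fun m hm => ?_⟩, ?_⟩, Finset.insert_erase hnD⟩
        · have h1 := Finset.mem_range.1 (hD.1 (Finset.mem_of_mem_erase hx))
          have h2 := Finset.ne_of_mem_erase hx
          rw [Finset.mem_range]; omega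
        · have h1 := hD.2 m (by omega)
          have h2 := countBelow_insert (Finset.notMem_erase n D) m
          rw [Finset.insert_erase hnD] at h2
          omega
        · rw [Finset.card_erase_of_mem hnD]; omega
      · left
        refine ⟨⟨fun x hx => ?_, fun m hm => hD.2 m (by omega)⟩, hc⟩
        have h1 := Finset.mem_range.1 (hD.1 hx)
        have h2 : x ≠ n := fun e => hnD (e ▸ hx)
        rw [Finset.mem_range]; omega
    · have hle : ∀ {D : Finset ℕ}, D ⊆ Finset.range n → D.card = j + 1 →
          2 * countBelow D (n + 1) ≤ n + 1 := fun hs hc => by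
        rw [countBelow_eq_card_of_subset hs (by omega)]; omega
      rintro (⟨hD, hc⟩ | ⟨D, ⟨hD, hc⟩, rfl⟩)
      · refine ⟨⟨hD.1.trans (by simp), fun m hm => ?_⟩, hc⟩
        rcases hm.lt_or_eq with h1 | rfl
        · exact hD.2 m (by omega)
        · exact hle hD.1 hc
      · refine ⟨⟨?_, fun m hm => ?_⟩, ?_⟩
        · exact Finset.insert_subset (by simp) (hD.1.trans (by simp))
        · rw [countBelow_insert (hn hD)]
          rcases hm.lt_or_eq with h1 | rfl
          · have := hD.2 m (by omega)
            rw [if_neg (by omega)]; omega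
          · rw [countBelow_eq_card_of_subset hD.1 (by omega), if_pos (by omega)]; omega
        · rw [Finset.card_insert_of_notMem (hn hD), hc]
  unfold ballotNumber
  rw [hunion, Set.ncard_union_eq _ (finite_isBallot n _) ((finite_isBallot n _).image _),
    Set.InjOn.ncard_image]
  · rintro D ⟨hD, -⟩ D' ⟨hD', -⟩ e
    rw [← Finset.erase_insert (hn hD), ← Finset.erase_insert (hn hD'), e]
  · rw [Set.disjoint_left]
    rintro D ⟨hD, -⟩ ⟨D', -, rfl⟩
    exact hn hD (Finset.mem_insert_self _ _)

/-! ### 132-avoiding involutions satisfy the same recurrence -/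

/-- The `132`-avoiding involutions with `e` excedances. -/
def involutions132 (n e : ℕ) : Set (Equiv.Perm (Fin n)) :=
  {σ | (∀ x, σ (σ x) = x) ∧ (∀ x, x < σ x ↔ (x : ℕ) < e) ∧
    ∀ x y z, x < y → y < z → σ x < σ z → σ z < σ y → False}

/-- The involutions fixing `p` whose excedances are the points before `p`, and which avoid `132`
away from `p`. -/
def involutions132Off {n : ℕ} (p : Fin (n + 1)) : Set (Equiv.Perm (Fin (n + 1))) :=
  {σ | σ p = p ∧ (∀ x, σ (σ x) = x) ∧ (∀ x, x < σ x ↔ (x : ℕ) < p) ∧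
    ∀ x y z, x ≠ p → y ≠ p → z ≠ p → x < y → y < z → σ x < σ z → σ z < σ y → False}

/-- Deleting the fixed point `p` is a bijection: `p.succAbove` preserves order and the relation
"before `p`". -/
theorem ncard_involutions132Off {n : ℕ} (p : Fin (n + 1)) :
    (involutions132Off p).ncard = (involutions132 n p).ncard := by
  symm
  have hex : ∀ x, x ≠ p → ∃ y, p.succAbove y = x := fun x hx => Fin.exists_succAbove_eq hx
  let ins : Equiv.Perm (Fin n) → Equiv.Perm (Fin (n + 1)) := fun τ =>
    (finSuccEquiv' p).trans (τ.optionCongr.trans (finSuccEquiv' p).symm)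
  have hp : ∀ τ, ins τ p = p := fun τ => by simp [ins]
  have hs : ∀ τ x, ins τ (p.succAbove x) = p.succAbove (τ x) := fun τ x => by simp [ins]
  have hlt : ∀ x : Fin n, ((p.succAbove x : Fin (n + 1)) : ℕ) < p ↔ (x : ℕ) < p := fun x => by
    rw [← Fin.lt_def, Fin.succAbove_lt_iff_castSucc_lt]; rfl
  apply Set.ncard_congr (fun τ _ => ins τ)
  · rintro τ ⟨h1, h2, h3⟩
    refine ⟨hp τ, fun x => ?_, fun x => ?_, fun x y z hx hy hz => ?_⟩
    · by_cases hx : x = p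
      · rw [hx, hp, hp]
      · obtain ⟨x, rfl⟩ := hex x hx
        rw [hs, hs, h1]
    · by_cases hx : x = p
      · rw [hx, hp]; simp
      · obtain ⟨x, rfl⟩ := hex x hx
        rw [hs, Fin.succAbove_lt_succAbove_iff, h2, hlt]
    · obtain ⟨x, rfl⟩ := hex x hx
      obtain ⟨y, rfl⟩ := hex y hy
      obtain ⟨z, rfl⟩ := hex z hz
      simp only [hs, Fin.succAbove_lt_succAbove_iff]
      exact h3 x y z
  · intro τ τ' _ _ h
    ext x
    have := hs τ x
    rw [h, hs, Fin.succAbove_right_inj] at this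
    rw [this]
  · rintro σ ⟨h0, h1, h2, h3⟩
    have hne : ∀ x, ∃ y, p.succAbove y = σ (p.succAbove x) := fun x =>
      hex _ fun hc => Fin.succAbove_ne p x (σ.injective (hc.trans h0.symm))
    choose f hf using hne
    have hinv : Function.Involutive f := fun x => by
      apply Fin.succAbove_right_injective (p := p)
      rw [hf, hf, h1]
    refine ⟨hinv.toPerm f, ⟨hinv, fun x => ?_, fun x y z => ?_⟩, ?_⟩
    · rw [Function.Involutive.coe_toPerm, ← Fin.succAbove_lt_succAbove_iff (p := p), hf, h2, hlt]
    · have := h3 _ _ _ (Fin.succAbove_ne p x) (Fin.succAbove_ne p y) (Fin.succAbove_ne p z)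
      simpa only [Function.Involutive.coe_toPerm, ← hf, Fin.succAbove_lt_succAbove_iff] using this
    · apply Equiv.ext
      intro x
      by_cases hx : x = p
      · rw [hx, hp, h0]
      · obtain ⟨x, rfl⟩ := hex x hx
        rw [hs, ← hf]
        rfl

theorem apply_eq_self_of_le {n e : ℕ} {σ : Equiv.Perm (Fin n)} (h1 : ∀ x, σ (σ x) = x)
    (h2 : ∀ x, x < σ x ↔ (x : ℕ) < e) {x : Fin n} (hx : e ≤ x) (hx' : e ≤ σ x) : σ x = x := by
  have h3 := mt (h2 x).1 (by omega)
  have h4 := mt (h2 (σ x)).1 (by omega)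
  rw [h1] at h4
  omega

theorem le_apply_of_lt {n e : ℕ} {σ : Equiv.Perm (Fin n)} (h1 : ∀ x, σ (σ x) = x)
    (h2 : ∀ x, x < σ x ↔ (x : ℕ) < e) {x : Fin n} (hx : (x : ℕ) < e) : e ≤ σ x := by
  by_contra hc
  have h3 := (h2 (σ x)).2 (by omega)
  have h4 := (h2 x).2 hx
  rw [h1] at h3
  omega

/-- A fixed `p` right after the excedances lies in no 132: earlier values exceed `p`, and later
points with values above `p` are fixed. -/
theorem setOf_involutions132_fixed {n : ℕ} (p : Fin (n + 1)) :
    {σ ∈ involutions132 (n + 1) p | σ p = p} = involutions132Off p := by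
  ext σ
  constructor
  · rintro ⟨⟨h1, h2, h3⟩, h0⟩
    exact ⟨h0, h1, h2, fun x y z _ _ _ => h3 x y z⟩
  · rintro ⟨h0, h1, h2, h3⟩
    refine ⟨⟨h1, h2, fun x y z hxy hyz hσ hσ' => ?_⟩, h0⟩
    have fix := fun x => apply_eq_self_of_le h1 h2 (x := x)
    have big := fun x => le_apply_of_lt h1 h2 (x := x)
    by_cases hx : x = p
    · subst hx
      have hy := fix y (by omega) (by omega)
      have hz := fix z (by omega) (by omega)
      omega
    by_cases hy : y = p
    · subst hy
      have := big x (by omega)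
      omega
    by_cases hz : z = p
    · subst hz
      have := big x (by omega)
      omega
    exact h3 x y z hx hy hz hxy hyz hσ hσ'

theorem mul_swap_apply {n : ℕ} {σ : Equiv.Perm (Fin n)} (p d : Fin n) :
    (σ * Equiv.swap p d) p = σ d ∧ (σ * Equiv.swap p d) d = σ p ∧
      ∀ x, x ≠ p → x ≠ d → (σ * Equiv.swap p d) x = σ x := by
  refine ⟨by simp, by simp, fun x hx hd => ?_⟩
  rw [Equiv.Perm.mul_apply, Equiv.swap_apply_of_ne_of_ne hx hd]

/-- In a `132`-avoiding involution with excedances `0, …, p` not fixing `p + 1`, the partner of `p`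
comes before every fixed point. -/
theorem apply_lt_of_apply_eq_self {n : ℕ} {p q : Fin (n + 1)} (hq : (q : ℕ) = p + 1)
    {σ : Equiv.Perm (Fin (n + 1))} (h : σ ∈ involutions132 (n + 1) (p + 1)) (hσq : σ q ≠ q)
    {g : Fin (n + 1)} (hg : σ g = g) : σ p < g := by
  obtain ⟨h1, h2, h3⟩ := h
  have hgp : (p : ℕ) + 1 ≤ g := by
    by_contra hc
    have := (h2 g).2 (by omega)
    omega
  have hgq : g ≠ q := fun e => hσq (e ▸ hg)
  have hq1 := mt (h2 q).1 (by omega)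
  have hpp := (h2 p).2 (by omega)
  by_cases ha : σ q = p
  · rw [← ha, h1]
    omega
  · have hgne : g ≠ σ p := fun e => by
      have := h1 p
      rw [← e, hg] at this
      omega
    have hbig := le_apply_of_lt h1 h2 (x := σ q) (by omega)
    by_contra hc
    -- The positions `σ q < p < g` would carry the values `q < g < σ p` in the order 132.
    exact h3 (σ q) p g (by omega) (by omega) (by rw [h1, hg]; omega) (by omega)

/-- The 2-cycle of the last excedance `p` is split into two fixed points. A 132 using the new fixed
point `d = σ p` yields one in `σ`, through `d` with its old value `p`, or through `p` in place of
`d`. -/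
theorem mul_swap_mem_involutions132Off {n : ℕ} {p : Fin (n + 1)}
    {σ : Equiv.Perm (Fin (n + 1))} (h : σ ∈ involutions132 (n + 1) (p + 1)) :
    σ * Equiv.swap p (σ p) ∈ involutions132Off p := by
  obtain ⟨h1, h2, h3⟩ := h
  have fix := fun x => apply_eq_self_of_le h1 h2 (x := x)
  have big := fun x => le_apply_of_lt h1 h2 (x := x)
  obtain ⟨e1, e2, e3⟩ := mul_swap_apply (σ := σ) p (σ p)
  rw [h1] at e1
  have hdp := big p (by omega)
  have hσd := h1 p
  set d := σ p with hd
  set τ := σ * Equiv.swap p d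
  have hne : ∀ x, x ≠ p → x ≠ d → σ x ≠ p ∧ σ x ≠ d := fun x hx hxd =>
    ⟨fun e => hxd (σ.injective (e.trans hσd.symm)), fun e => hx (σ.injective (e.trans hd))⟩
  refine ⟨e1, fun x => ?_, fun x => ?_, fun x y z hx hy hz hxy hyz hσ hσ' => ?_⟩
  · by_cases hx : x = p
    · rw [hx, e1, e1]
    by_cases hx' : x = d
    · rw [hx', e2, e2]
    rw [e3 x hx hx', e3 _ (hne x hx hx').1 (hne x hx hx').2, h1]
  · by_cases hx : x = p
    · rw [hx, e1]; simp
    by_cases hx' : x = d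
    · rw [hx', e2]; omega
    rw [e3 x hx hx', h2]
    omega
  · by_cases hxd : x = d
    · subst hxd
      rw [e2, e3 z hz (by omega)] at hσ
      rw [e3 z hz (by omega), e3 y hy (by omega)] at hσ'
      have := fix y (by omega) (by omega)
      have := fix z (by omega) (by omega)
      omega
    rw [e3 x hx hxd] at hσ
    by_cases hyd : y = d
    · rw [hyd] at hxy hyz hσ'
      rw [e3 z hz (by omega)] at hσ
      rw [e2, e3 z hz (by omega)] at hσ'
      have hz1 : (σ z : ℕ) < p + 1 := by
        by_contra hc
        have := fix z (by omega) (by omega)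
        omega
      have := (hne z hz (by omega)).1
      exact h3 x d z hxy hyz hσ (by omega)
    rw [e3 y hy hyd] at hσ'
    by_cases hzd : z = d
    · rw [hzd] at hyz hσ hσ'
      rw [e2] at hσ hσ'
      have hy1 : (y : ℕ) < p + 1 := by
        by_contra hc
        have := fix y (by omega) (by omega)
        omega
      exact h3 x y p hxy (by omega) hσ hσ'
    rw [e3 z hz hzd] at hσ hσ'
    exact h3 x y z hxy hyz hσ hσ'

/-- Inverse of the splitting: `p` is joined to the least other fixed point, as
`apply_lt_of_apply_eq_self` forces. -/
theorem mul_swap_mem_involutions132 {n : ℕ} {p q d : Fin (n + 1)} (hq : (q : ℕ) = p + 1)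
    {σ : Equiv.Perm (Fin (n + 1))} (h : σ ∈ involutions132Off p) (hdp : d ≠ p) (hd : σ d = d)
    (hmin : ∀ g, g ≠ p → σ g = g → d ≤ g) :
    σ * Equiv.swap p d ∈ involutions132 (n + 1) (p + 1) ∧ (σ * Equiv.swap p d) q ≠ q := by
  obtain ⟨h0, h1, h2, h3⟩ := h
  have fix := fun x => apply_eq_self_of_le h1 h2 (x := x)
  have big := fun x => le_apply_of_lt h1 h2 (x := x)
  obtain ⟨e1, e2, e3⟩ := mul_swap_apply (σ := σ) p d
  rw [hd] at e1
  rw [h0] at e2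
  have hpd : p < d := by
    by_contra hc
    have := (h2 d).2 (by omega)
    omega
  set τ := σ * Equiv.swap p d
  have hne : ∀ x, x ≠ p → x ≠ d → σ x ≠ p ∧ σ x ≠ d := fun x hx hxd =>
    ⟨fun e => hx (σ.injective (e.trans h0.symm)), fun e => hxd (σ.injective (e.trans hd.symm))⟩
  refine ⟨⟨fun x => ?_, fun x => ?_, fun x y z hxy hyz hσ hσ' => ?_⟩, ?_⟩
  · by_cases hx : x = p
    · rw [hx, e1, e2]
    by_cases hx' : x = d
    · rw [hx', e2, e1]
    rw [e3 x hx hx', e3 _ (hne x hx hx').1 (hne x hx hx').2, h1]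
  · by_cases hx : x = p
    · rw [hx, e1]; omega
    by_cases hx' : x = d
    · rw [hx', e2]; omega
    rw [e3 x hx hx', h2]
    omega
  -- By minimality of `d`, any further point after `p` with value at least `p` is fixed and lies
  -- after `d`; such points are in increasing order.
  · have val : ∀ w, w ≠ p → w ≠ d → p < w → p ≤ σ w → d < w ∧ σ w = w := fun w hw hw' h4 h5 => by
      have h6 := fix w (by omega) (by omega)
      have h7 := hmin w hw h6
      exact ⟨by omega, h6⟩
    by_cases hxp : x = p
    · subst hxp
      rw [e1] at hσ
      have hyd : y ≠ d := fun e => by rw [e, e2] at hσ'; omega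
      have hzd : z ≠ d := fun e => by rw [e, e2] at hσ; omega
      rw [e3 z (by omega) hzd] at hσ
      rw [e3 z (by omega) hzd, e3 y (by omega) hyd] at hσ'
      have := val y (by omega) hyd (by omega) (by omega)
      have := val z (by omega) hzd (by omega) (by omega)
      omega
    by_cases hxd : x = d
    · subst hxd
      rw [e2, e3 z (by omega) (by omega)] at hσ
      rw [e3 z (by omega) (by omega), e3 y (by omega) (by omega)] at hσ'
      have := val y (by omega) (by omega) (by omega) (by omega)
      have := val z (by omega) (by omega) (by omega) (by omega)
      omega
    rw [e3 x hxp hxd] at hσ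
    by_cases hyp : y = p
    · subst hyp
      have hx1 := big x (by omega)
      have hzd : z ≠ d := fun e => by rw [e, e2] at hσ; omega
      rw [e3 z (by omega) hzd] at hσ
      rw [e3 z (by omega) hzd, e1] at hσ'
      have := val z (by omega) hzd (by omega) (by omega)
      omega
    by_cases hyd : y = d
    · rw [hyd] at hxy hyz hσ'
      rw [e3 z (by omega) (by omega)] at hσ
      rw [e2, e3 z (by omega) (by omega)] at hσ'
      exact h3 x d z hxp hdp (by omega) hxy hyz hσ (by omega)
    rw [e3 y hyp hyd] at hσ'
    by_cases hzp : z = p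
    · rw [hzp] at hyz hσ hσ'
      rw [e1] at hσ hσ'
      exact h3 x y d hxp hyp hdp hxy (by omega) (by omega) (by omega)
    by_cases hzd : z = d
    · rw [hzd] at hyz hσ hσ'
      rw [e2] at hσ hσ'
      have hx1 : (p : ℕ) ≤ x := by
        by_contra hc
        have := big x (by omega)
        omega
      have := val y hyp hyd (by omega) (by omega)
      omega
    rw [e3 z hzp hzd] at hσ hσ'
    exact h3 x y z hxp hyp hzp hxy hyz hσ hσ'
  · by_cases hqd : q = d
    · rw [hqd, e2]; omega
    · rw [e3 q (by omega) hqd]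
      intro hc
      have := hmin q (by omega) hc
      omega

theorem ncard_involutions132_not_fixed {n : ℕ} {p q : Fin (n + 1)} (hq : (q : ℕ) = p + 1)
    (hn : 2 * (p + 1 : ℕ) ≤ n + 1) :
    {σ ∈ involutions132 (n + 1) (p + 1) | σ q ≠ q}.ncard = (involutions132Off p).ncard := by
  apply Set.ncard_congr (fun σ _ => σ * Equiv.swap p (σ p))
  · rintro σ ⟨h, -⟩
    exact mul_swap_mem_involutions132Off h
  -- If `τ p < σ p`, then `τ p` is a fixed point of `σ` preceding `σ p`, which is impossible.
  · have key : ∀ σ τ : Equiv.Perm (Fin (n + 1)), σ ∈ involutions132 (n + 1) (p + 1) → σ q ≠ q →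
        τ ∈ involutions132 (n + 1) (p + 1) →
        σ * Equiv.swap p (σ p) = τ * Equiv.swap p (τ p) → σ p ≤ τ p := by
      intro σ τ hσ hσq hτ h
      by_contra hc
      obtain ⟨-, -, e3⟩ := mul_swap_apply (σ := σ) p (σ p)
      obtain ⟨-, e2, -⟩ := mul_swap_apply (σ := τ) p (τ p)
      have hlt := (hτ.2.1 p).2 (by omega)
      rw [← h, e3 (τ p) (by omega) (by omega)] at e2
      exact hc (apply_lt_of_apply_eq_self hq hσ hσq e2).le
    rintro σ τ ⟨hσ, hσq⟩ ⟨hτ, hτq⟩ h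
    have hp : σ p = τ p := le_antisymm (key σ τ hσ hσq hτ h) (key τ σ hτ hτq hσ h.symm)
    rw [hp] at h
    exact mul_right_cancel h
  · intro σ h
    obtain ⟨h0, h1, h2, -⟩ := id h
    have hexc := exc_eq_of_lt_apply_iff (by omega) h2
    have hfp := fp_add_two_mul_exc h1
    -- There are `n + 1 - 2 * p ≥ 2` fixed points by `hn`, hence one besides `p`.
    obtain ⟨g, hg, hgp⟩ := Finset.exists_mem_ne (s := Finset.univ.filter fun i => σ i = i)
      (by unfold fp at hfp; omega) p
    obtain ⟨d, hd, hmin⟩ := Finset.exists_min_image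
      (Finset.univ.filter fun i => i ≠ p ∧ σ i = i) id ⟨g, by simpa [hgp] using hg⟩
    simp only [Finset.mem_filter, Finset.mem_univ, true_and, id] at hd hmin
    obtain ⟨h4, h5⟩ := mul_swap_mem_involutions132 hq h hd.1 hd.2 fun g h6 h7 => hmin g ⟨h6, h7⟩
    refine ⟨σ * Equiv.swap p d, ⟨h4, h5⟩, ?_⟩
    rw [(mul_swap_apply (σ := σ) p d).1, hd.2, mul_assoc, Equiv.swap_mul_self, mul_one]

/-- Split on whether the first non-excedance `e + 1` is fixed. If so, delete it; if not, split the
2-cycle of `e` and delete `e`. -/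
theorem ncard_involutions132_succ_succ {n e : ℕ} (h : 2 * (e + 1) ≤ n + 1) :
    (involutions132 (n + 1) (e + 1)).ncard =
      (involutions132 n (e + 1)).ncard + (involutions132 n e).ncard := by
  have h1 := ncard_involutions132Off (n := n) ⟨e + 1, by omega⟩
  have h2 := ncard_involutions132Off (n := n) ⟨e, by omega⟩
  rw [← setOf_involutions132_fixed] at h1
  rw [← ncard_involutions132_not_fixed (q := ⟨e + 1, by omega⟩) rfl h] at h2
  rw [← h1, ← h2, ← Set.ncard_union_eq]
  · congr 1
    ext σ
    simp only [Set.mem_union, Set.mem_ofPred_eq]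
    tauto
  · rw [Set.disjoint_left]
    rintro σ ⟨-, h3⟩ ⟨-, h4⟩
    exact h4 h3

theorem involutions132_zero (n : ℕ) : involutions132 n 0 = {1} := by
  refine Set.eq_singleton_iff_unique_mem.2 ⟨⟨fun x => rfl, fun x => by simp, ?_⟩, ?_⟩
  · intro x y z _ hyz _ h
    exact hyz.asymm h
  · rintro σ ⟨h1, h2, -⟩
    exact Equiv.ext fun x => apply_eq_self_of_le h1 h2 (Nat.zero_le _) (Nat.zero_le _)

theorem setOf_p132_eq_involutions132 {n e : ℕ} (he : e ≤ n) :
    {σ : Equiv.Perm (Fin n) | σ = σ⁻¹ ∧ Avoids σ p132 ∧ exc σ = e} = involutions132 n e := by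
  ext σ
  simp only [Set.mem_ofPred_eq, eq_inv_iff_apply_apply, involutions132]
  constructor
  · rintro ⟨h1, h2, rfl⟩
    exact ⟨h1, lt_apply_iff_of_avoids_p132 h1 h2, (avoids_p132_iff σ).1 h2⟩
  · rintro ⟨h1, h2, h3⟩
    exact ⟨h1, (avoids_p132_iff σ).2 h3, exc_eq_of_lt_apply_iff he h2⟩

theorem ncard_involutions132 {n e : ℕ} (he : e ≤ n) :
    (involutions132 n e).ncard = ballotNumber n e := by
  induction n generalizing e with
  | zero =>
    obtain rfl : e = 0 := by omega
    rw [involutions132_zero, Set.ncard_singleton, ballotNumber_zero]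
  | succ n ih =>
    cases e with
    | zero => rw [involutions132_zero, Set.ncard_singleton, ballotNumber_zero]
    | succ e =>
      by_cases h : 2 * (e + 1) ≤ n + 1
      · rw [ncard_involutions132_succ_succ h, ballotNumber_succ_succ h, ih (by omega),
          ih (by omega)]
      · rw [ballotNumber_eq_zero (by omega), Set.ncard_eq_zero, Set.eq_empty_iff_forall_notMem]
        rintro σ ⟨h1, h2, -⟩
        have h3 := exc_eq_of_lt_apply_iff he h2
        have h4 := fp_add_two_mul_exc h1
        omega

end RestrictedPerm

open RestrictedPerm in
theorem theorem4 (n i j k : ℕ) (hi : i ≤ n) (hj : j ≤ n) (hk : k ≤ n) :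
    {σ : Equiv.Perm (Fin n) | σ = σ⁻¹ ∧ RestrictedPerm.Avoids σ RestrictedPerm.p321 ∧
        RestrictedPerm.fp σ = i ∧ RestrictedPerm.exc σ = j ∧
        RestrictedPerm.lis σ = k}.ncard =
      {σ : Equiv.Perm (Fin n) | σ = σ⁻¹ ∧ RestrictedPerm.Avoids σ RestrictedPerm.p132 ∧
        RestrictedPerm.fp σ = i ∧ RestrictedPerm.exc σ = j ∧
        RestrictedPerm.rk σ = n - k}.ncard := by
  by_cases h : i + 2 * j = n ∧ k + j = n
  · have h1 := ncard_p321_eq_ballotNumber n j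
    have h2 := ncard_involutions132 hj
    rw [← setOf_p132_eq_involutions132 hj, ← h1] at h2
    convert h2.symm using 2
    · ext σ
      simp only [Set.mem_ofPred_eq]
      refine ⟨fun ⟨a, b, _, d, _⟩ => ⟨a, b, d⟩, fun ⟨a, b, d⟩ => ⟨a, b, ?_, d, ?_⟩⟩
      · have := fp_add_two_mul_exc ((eq_inv_iff_apply_apply σ).1 a)
        omega
      · have := lis_add_exc_of_avoids_p321 ((eq_inv_iff_apply_apply σ).1 a) b
        omega
    · ext σ
      simp only [Set.mem_ofPred_eq]
      refine ⟨fun ⟨a, b, _, d, _⟩ => ⟨a, b, d⟩, fun ⟨a, b, d⟩ => ⟨a, b, ?_, d, ?_⟩⟩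
      · have := fp_add_two_mul_exc ((eq_inv_iff_apply_apply σ).1 a)
        omega
      · have := rk_eq_exc_of_avoids_p132 ((eq_inv_iff_apply_apply σ).1 a) b
        omega
  -- Outside these relations both sets are empty; `hk` keeps `n - k` from truncating.
  · congr 1
    trans (∅ : Set (Equiv.Perm (Fin n)))
    · rw [Set.eq_empty_iff_forall_notMem]
      rintro σ ⟨a, b, c, d, e⟩
      have h1 := fp_add_two_mul_exc ((eq_inv_iff_apply_apply σ).1 a)
      have h2 := lis_add_exc_of_avoids_p321 ((eq_inv_iff_apply_apply σ).1 a) b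
      omega
    · symm
      rw [Set.eq_empty_iff_forall_notMem]
      rintro σ ⟨a, b, c, d, e⟩
      have h1 := fp_add_two_mul_exc ((eq_inv_iff_apply_apply σ).1 a)
      have h2 := rk_eq_exc_of_avoids_p132 ((eq_inv_iff_apply_apply σ).1 a) b
      omega
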